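/- Work over $\mathbb F_2$, with differentials of degree $+1$. Let $\mathcal E$ be the free differential graded operad generated by the standard bar resolution of $\mathbb F_2[\Sigma_2]$, placed in arity 2: it is free over $\mathbb F_2[\Sigma_2]$ on $e_i$ ($i\ge 0$) of degree $-i$, with $d(e_i)=e_{i-1}+e_{i-1}\cdot(21)$; put $e_i=0$ for $i<0$. Permutations are written $(\sigma(1)\ldots\sigma(n))$ and act on the right, and $o(a,b)$ is operadic composition. For $\sigma,\tau,\nu\in\mathcal E(2)$ let $\sigma(\tau,\nu)\cdot F=(\sigma\cdot(21))(\tau,\nu)=\sigma(\nu,\tau)\cdot(3412)$, extended linearly. For integers $i,j$ let $(i,j)=\frac{(i+j)!}{i!\,j!}\in\mathbb F_2$ if $i,j\ge 0$, and $(i,j)=0$ otherwise. For integers $m\ge 1$, $n$, $x$, let $k$ be such that $2^k\le m\le 2^{k+1}-1$, and define $[u^m_n]_x\in\mathcal E(4)^{-n-x}$ by $[u^m_0]_x=e_x\cdot(21)^{m-1}(e_0,e_0)$ and, for $n\neq 0$, $$[u^m_n]_x=\sum_{i=0}^{2^{k+1}-1}\ \sum_{\delta\in\mathbb Z,\ 0\le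 2^{k+1}\delta-i\le n}(n-m+i,m-1)\Big[(i,m)\,e_x\cdot(21)^{m-1}(e_{2^{k+1}\delta-i},e_{n+i-2^{k+1}\delta})+(i-1,m)\,e_x\cdot(21)^{m-1}(e_{2^{k+1}\delta-i},e_{n+i-2^{k+1}\delta}\cdot(21))\Big]$$ (so $[u^m_n]_x=0$ for $n<0$); put $[u^0_n]_x=0$. For integers $n,p$ define $\alpha_{n,p}\in\mathcal E(4)^{-n}$ by $$\alpha_{n,p}=\sum_{s=0}^{n-p}[u^{s+1}_{s+p}]_{n-s-p}+\sum_{s=0}^{n-p-1}[u^{s+1}_{s+p+1}]_{n-s-p-1}\cdot(3412),$$ where a sum whose upper limit is negative is zero. Then the following hold in $\mathcal E(4)$. 1. $[u^m_n]_x=0$ for all integers $m,n,x$ with $0<n<m$. 2. $[u^m_m]_x=e_x\cdot(21)^{m-1}(e_0,e_m)+e_x\cdot(21)^{m-1}(e_m,e_0\cdot(21))$ for all $m\ge 1$ and $x\in\mathbb Z$. 3. For all $m\ge 0$ and $n,x\in\mathbb Z$, $$d[u^{m+1}_{n+1}]_x=[u^{m+1}_n]_x\cdot(\mathrm{Id}+(2143))+[u^m_n]_x\cdot(F+(4321))+[u^{m+1}_{n+1}]_{x-1}\cdot(\mathrm{Id}+F).$$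 4. $\alpha_{n,p}=0$ for all integers $n,p$ with $p<0$. 5. For all integers $n,p$, $\ d\alpha_{n,p}=\alpha_{n-1,p-1}\cdot(\mathrm{Id}+(2143))+\alpha_{n-1,p}\cdot(\mathrm{Id}+(4321))$. -/

import Mathlib

namespace AdemCartan

/-- Planar binary trees with leaves labelled by `α` and with internal vertices decorated by
natural numbers.  A vertex decorated by `i` stands for the operation `e_i` applied to its
left and right branch. -/
inductive BTree (α : Type) : Type
  | leaf (a : α) : BTree α
  | node (i : ℕ) (l r : BTree α) : BTree α

namespace BTree

/-- The multiset of leaf labels. -/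
def leaves {α : Type} : BTree α → Multiset α
  | leaf a => {a}
  | node _ l r => l.leaves + r.leaves

/-- Sum of the decorations, so that the tree has cohomological degree `-weight`. -/
def weight {α : Type} : BTree α → ℕ
  | leaf _ => 0
  | node i l r => i + l.weight + r.weight

/-- Relabelling of leaves. -/
def map {α β : Type} (f : α → β) : BTree α → BTree β
  | leaf a => leaf (f a)
  | node i l r => node i (l.map f) (r.map f)

/-- Exchange of the two branches at the root. -/
def swapRoot {α : Type} : BTree α → BTree α
  | leaf a => leaf a
  | node i l r => node i r l

theorem leaves_map {α β : Type} (f : α → β) (t : BTree α) :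
    (t.map f).leaves = t.leaves.map f := by
  induction t with
  | leaf a => simp [map, leaves]
  | node i l r hl hr => simp [map, leaves, hl, hr]

theorem weight_map {α β : Type} (f : α → β) (t : BTree α) : (t.map f).weight = t.weight := by
  induction t with
  | leaf a => simp [map, weight]
  | node i l r hl hr => simp [map, weight, hl, hr]

theorem leaves_swapRoot {α : Type} (t : BTree α) : t.swapRoot.leaves = t.leaves := by
  cases t with
  | leaf a => rfl
  | node i l r => simp [swapRoot, leaves, add_comm]

theorem map_map {α β γ : Type} (f : α → β) (g : β → γ) (t : BTree α) :
    (t.map f).map g = t.map (g ∘ f) := by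
  induction t with
  | leaf a => rfl
  | node i l r hl hr => simp [map, hl, hr]

end BTree

open BTree

/-- `𝔽₂`-linear combinations of trees. -/
abbrev Mag (α : Type) : Type := BTree α →₀ ZMod 2

noncomputable section

/-- The bilinear operation `(a, b) ↦ e_i(a, b)`, joining two trees at a root decorated by `i`. -/
def op {α : Type} (i : ℕ) : Mag α →ₗ[ZMod 2] Mag α →ₗ[ZMod 2] Mag α :=
  Finsupp.linearCombination (ZMod 2) fun l =>
    Finsupp.linearCombination (ZMod 2) fun r => Finsupp.single (node i l r) 1

/-- `d(e_i) (l, r)` where `d(e_i) = e_{i-1} + e_{i-1}·(21)` and `e_{-1} = 0`. -/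
def dVertex {α : Type} (l r : BTree α) : ℕ → Mag α
  | 0 => 0
  | j + 1 => Finsupp.single (node j l r) 1 + Finsupp.single (node j r l) 1

/-- The differential of a tree: the derivation determined by the values of `d(e_i)`. -/
def dTree {α : Type} : BTree α → Mag α
  | leaf _ => 0
  | node i l r => dVertex l r i
      + op i (dTree l) (Finsupp.single r 1) + op i (Finsupp.single l 1) (dTree r)

/-- The differential on linear combinations of trees. -/
def dMag {α : Type} : Mag α →ₗ[ZMod 2] Mag α :=
  Finsupp.linearCombination (ZMod 2) dTree

/-- Substitution of `f a` for every leaf labelled `a`. -/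
def substTree {α β : Type} (f : α → Mag β) : BTree α → Mag β
  | leaf a => f a
  | node i l r => op i (substTree f l) (substTree f r)

/-- Linear extension of `substTree`. -/
def subst {α β : Type} (f : α → Mag β) : Mag α →ₗ[ZMod 2] Mag β :=
  Finsupp.linearCombination (ZMod 2) (substTree f)

/-- Combinations of trees whose multiset of leaf labels is `A`. -/
def withLeaves {α : Type} (A : Multiset α) : Submodule (ZMod 2) (Mag α) :=
  Finsupp.supported (ZMod 2) (ZMod 2) {t | t.leaves = A}

/-- Combinations of trees of cohomological degree `k`, that is of weight `-k`. -/
def ofDegree {α : Type} (k : ℤ) : Submodule (ZMod 2) (Mag α) :=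
  Finsupp.supported (ZMod 2) (ZMod 2) {t | (t.weight : ℤ) = -k}

theorem linearCombination_mem {S T : Type} {P : Set S} {Q : Submodule (ZMod 2) (T →₀ ZMod 2)}
    {f : S → (T →₀ ZMod 2)} (hf : ∀ t ∈ P, f t ∈ Q) {a : S →₀ ZMod 2}
    (ha : a ∈ Finsupp.supported (ZMod 2) (ZMod 2) P) :
    Finsupp.linearCombination (ZMod 2) f a ∈ Q := by
  rw [Finsupp.linearCombination_apply]
  exact Submodule.sum_mem _ fun t ht => Q.smul_mem _ (hf t (ha ht))

theorem lmapDomain_mem {S T : Type} {P : Set S} {Q : Set T} {g : S → T}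
    (hg : ∀ t ∈ P, g t ∈ Q) {a : S →₀ ZMod 2}
    (ha : a ∈ Finsupp.supported (ZMod 2) (ZMod 2) P) :
    Finsupp.lmapDomain (ZMod 2) (ZMod 2) g a ∈ Finsupp.supported (ZMod 2) (ZMod 2) Q := by
  rw [Finsupp.lmapDomain_apply, Finsupp.mapDomain]
  exact Submodule.sum_mem _ fun t ht => Finsupp.single_mem_supported _ _ (hg t (ha ht))

theorem op_single {α : Type} (i : ℕ) (l r : BTree α) :
    op i (Finsupp.single l 1) (Finsupp.single r 1) = Finsupp.single (node i l r) 1 := by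
  simp [op]

theorem op_mem_supported {α : Type} (i : ℕ) {P Q R : Set (BTree α)}
    (h : ∀ l ∈ P, ∀ r ∈ Q, node i l r ∈ R) {a b : Mag α}
    (ha : a ∈ Finsupp.supported (ZMod 2) (ZMod 2) P)
    (hb : b ∈ Finsupp.supported (ZMod 2) (ZMod 2) Q) :
    op i a b ∈ Finsupp.supported (ZMod 2) (ZMod 2) R := by
  rw [op, Finsupp.linearCombination_apply, Finsupp.sum, LinearMap.sum_apply]
  refine Submodule.sum_mem _ fun l hl => ?_
  rw [LinearMap.smul_apply]
  exact Submodule.smul_mem _ _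
    (linearCombination_mem (fun r hr => Finsupp.single_mem_supported _ _ (h l (ha hl) r hr)) hb)

theorem op_mem_withLeaves {α : Type} (i : ℕ) {A B : Multiset α} {a b : Mag α}
    (ha : a ∈ withLeaves A) (hb : b ∈ withLeaves B) : op i a b ∈ withLeaves (A + B) :=
  op_mem_supported i (fun l hl r hr => by
    simp only [Set.mem_ofPred_eq] at hl hr ⊢; simp [leaves, hl, hr]) ha hb

theorem op_mem_ofDegree {α : Type} (i : ℕ) {j k : ℤ} {a b : Mag α}
    (ha : a ∈ ofDegree j) (hb : b ∈ ofDegree k) : op i a b ∈ ofDegree (-(i : ℤ) + j + k) :=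
  op_mem_supported i (fun l hl r hr => by
    simp only [Set.mem_ofPred_eq] at hl hr ⊢; simp only [weight]; push_cast; omega) ha hb

theorem single_mem_withLeaves {α : Type} (t : BTree α) :
    Finsupp.single t 1 ∈ withLeaves t.leaves :=
  Finsupp.single_mem_supported _ _ rfl

theorem dTree_mem {α : Type} (t : BTree α) : dTree t ∈ withLeaves t.leaves := by
  induction t with
  | leaf a => exact Submodule.zero_mem _
  | node i l r hl hr =>
    refine Submodule.add_mem _ (Submodule.add_mem _ ?_ ?_) ?_
    · cases i with
      | zero => exact Submodule.zero_mem _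
      | succ j =>
        refine Submodule.add_mem _ (Finsupp.single_mem_supported _ _ rfl)
          (Finsupp.single_mem_supported _ _ ?_)
        simp [leaves, add_comm]
    · exact op_mem_withLeaves i hl (single_mem_withLeaves r)
    · exact op_mem_withLeaves i (single_mem_withLeaves l) hr

theorem substTree_mem {α β : Type} {f : α → Mag β} {A : α → Multiset β}
    (hf : ∀ a, f a ∈ withLeaves (A a)) (t : BTree α) :
    substTree f t ∈ withLeaves (t.leaves.map A).sum := by
  induction t with
  | leaf a => simpa [substTree, leaves] using hf a
  | node i l r hl hr => simpa [substTree, leaves] using op_mem_withLeaves i hl hr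

/-- The arity `n` part of the free operad `𝓔` generated by the standard bar resolution of
`𝔽₂[Σ₂]`.  Since the bar resolution is the free `𝔽₂[Σ₂]`-module on the `e_i`, `i ≥ 0`, the
arity `n` part has for basis the planar binary trees with vertices decorated by the `e_i` and
with leaves labelled bijectively by the inputs (here `0, …, n-1` in place of `1, …, n`);
the element `e_i · (21)` is the tree with one vertex `e_i` and leaves exchanged. -/
def E (n : ℕ) : Submodule (ZMod 2) (Mag (Fin n)) :=
  withLeaves (Finset.univ : Finset (Fin n)).val

/-- The part of `𝓔(n)` of cohomological degree `k`. -/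
def homogeneous (n : ℕ) (k : ℤ) : Submodule (ZMod 2) (E n) :=
  (ofDegree k).comap (E n).subtype

/-- The differential of `𝓔(n)`. -/
def d {n : ℕ} : E n →ₗ[ZMod 2] E n :=
  dMag.restrict fun _ ha => linearCombination_mem (fun t ht => by
    have h := dTree_mem t
    rwa [show t.leaves = _ from ht] at h) ha

/-- The right action of `Σ_n` on `𝓔(n)`, written `a · σ`; as an operation,
`(a · σ)(x_1, …, x_n) = a(x_{σ⁻¹(1)}, …, x_{σ⁻¹(n)})`. -/
def act {n : ℕ} (σ : Equiv.Perm (Fin n)) : E n →ₗ[ZMod 2] E n :=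
  (Finsupp.lmapDomain (ZMod 2) (ZMod 2) (BTree.map ⇑σ⁻¹)).restrict fun a ha => by
    refine lmapDomain_mem (fun t ht => ?_) ha
    rw [Set.mem_ofPred_eq] at ht ⊢
    rw [leaves_map, ht, ← Finset.map_univ_equiv σ⁻¹]
    simp

theorem mapDomain_mem {α β : Type} (f : α → β) {A : Multiset α} {a : Mag α}
    (ha : a ∈ withLeaves A) : Finsupp.mapDomain (BTree.map f) a ∈ withLeaves (A.map f) := by
  refine lmapDomain_mem (fun t ht => ?_) ha
  rw [Set.mem_ofPred_eq] at ht ⊢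
  rw [leaves_map, ht]

/-- The operadic composition `o(a, b)` of a binary operation `o` with `a` and `b`: the inputs of
`a` come first, followed by those of `b`. -/
def comp {m n : ℕ} (o : E 2) (a : E m) (b : E n) : E (m + n) :=
  ⟨subst ![Finsupp.mapDomain (BTree.map (Fin.castAdd n)) a.1,
      Finsupp.mapDomain (BTree.map (Fin.natAdd m)) b.1] o.1, by
    let A : Fin 2 → Multiset (Fin (m + n)) :=
      ![(Finset.univ : Finset (Fin m)).val.map (Fin.castAdd n),
        (Finset.univ : Finset (Fin n)).val.map (Fin.natAdd m)]
    refine linearCombination_mem (fun t ht => ?_) o.2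
    have h := substTree_mem (f := ![Finsupp.mapDomain (BTree.map (Fin.castAdd n)) a.1,
      Finsupp.mapDomain (BTree.map (Fin.natAdd m)) b.1]) (A := A) (fun i => by
        fin_cases i
        · exact mapDomain_mem _ a.2
        · exact mapDomain_mem _ b.2) t
    rw [show t.leaves = _ from ht] at h
    have hA : ((Finset.univ : Finset (Fin 2)).val.map A).sum
        = (Finset.univ : Finset (Fin (m + n))).val := by
      change ∑ i, A i = _
      rw [Fin.sum_univ_two]
      have hu := congrArg Finset.val (Finset.map_univ_equiv (finSumFinEquiv (m := m) (n := n)))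
      rw [← hu, Finset.map_val, ← Finset.univ_disjSum_univ, Finset.val_disjSum,
        Multiset.disjSum, Multiset.map_add, Multiset.map_map, Multiset.map_map]
      rfl
    rwa [hA] at h⟩

/-- The transposition `(21)` of `Σ₂`. -/
def perm21 : Equiv.Perm (Fin 2) := Equiv.swap 0 1

/-- The permutation `(2143)` of `Σ₄`. -/
def perm2143 : Equiv.Perm (Fin 4) := ⟨![1, 0, 3, 2], ![1, 0, 3, 2], by decide, by decide⟩

/-- The permutation `(4321)` of `Σ₄`. -/
def perm4321 : Equiv.Perm (Fin 4) := ⟨![3, 2, 1, 0], ![3, 2, 1, 0], by decide, by decide⟩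

/-- The permutation `(3412)` of `Σ₄`. -/
def perm3412 : Equiv.Perm (Fin 4) := ⟨![2, 3, 0, 1], ![2, 3, 0, 1], by decide, by decide⟩

/-- The generator `e_i ∈ 𝓔(2)` of degree `-i`, with `e_i = 0` for `i < 0`. -/
def e (i : ℤ) : E 2 :=
  if 0 ≤ i then
    ⟨Finsupp.single (node i.toNat (leaf 0) (leaf 1)) 1,
      Finsupp.single_mem_supported _ _ rfl⟩
  else 0

/-- The operation `F`, exchange of the two inputs of the root:
`σ(τ, ν) · F = (σ · (21))(τ, ν)`. -/
def flip {n : ℕ} : E n →ₗ[ZMod 2] E n :=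
  (Finsupp.lmapDomain (ZMod 2) (ZMod 2) BTree.swapRoot).restrict fun a ha => by
    refine lmapDomain_mem (fun t ht => ?_) ha
    rw [Set.mem_ofPred_eq] at ht ⊢
    rw [leaves_swapRoot, ht]

/-- May's symbol `(i, j) = (i + j)! / (i! j!) ∈ 𝔽₂`, which is `0` if `i < 0` or `j < 0`. -/
def may (i j : ℤ) : ZMod 2 :=
  if 0 ≤ i ∧ 0 ≤ j then
    (((i + j).toNat.factorial / (i.toNat.factorial * j.toNat.factorial) : ℕ) : ZMod 2)
  else 0

/-- The elements `[u^m_n]_x` of `𝓔(4)`.  Here `2 ^ k ≤ m ≤ 2 ^ (k + 1) - 1` for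
`k = Nat.log 2 m`, and `δ` runs through all integers with `0 ≤ 2 ^ (k + 1) δ - i ≤ n`
(these satisfy `0 ≤ δ ≤ n + i`).  By convention `[u^0_n]_x = 0`; for `n < 0` the sum is empty. -/
def u (m : ℕ) (n x : ℤ) : E 4 :=
  if m = 0 then 0
  else if n = 0 then comp (act (perm21 ^ (m - 1)) (e x)) (e 0) (e 0)
  else
    ∑ i ∈ Finset.range (2 ^ (Nat.log 2 m + 1)),
      ∑ δ ∈ (Finset.Icc (0 : ℤ) (n + i)).filter fun δ : ℤ =>
          0 ≤ 2 ^ (Nat.log 2 m + 1) * δ - i ∧ 2 ^ (Nat.log 2 m + 1) * δ - i ≤ n,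
        may (n - m + i) (m - 1) •
          (may i m •
              comp (act (perm21 ^ (m - 1)) (e x))
                (e (2 ^ (Nat.log 2 m + 1) * δ - i))
                (e (n + i - 2 ^ (Nat.log 2 m + 1) * δ))
            + may (i - 1) m •
              comp (act (perm21 ^ (m - 1)) (e x))
                (e (2 ^ (Nat.log 2 m + 1) * δ - i))
                (act perm21 (e (n + i - 2 ^ (Nat.log 2 m + 1) * δ))))

/-- The elements `α_{n,p}` of `𝓔(4)`; the sums run over `0 ≤ s ≤ n - p` and over
`0 ≤ s ≤ n - p - 1`. -/
def α (n p : ℤ) : E 4 :=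
  ∑ s ∈ Finset.range (n - p + 1).toNat, u (s + 1) (s + p) (n - s - p)
    + ∑ s ∈ Finset.range (n - p).toNat, act perm3412 (u (s + 1) (s + p + 1) (n - s - p - 1))

/-! Consistency of the definitions -/

theorem d_e (i : ℤ) : d (e i) = e (i - 1) + act perm21 (e (i - 1)) := by
  apply Subtype.ext
  rcases lt_trichotomy i 0 with h | rfl | h
  · have h1 : ¬ 0 ≤ i := by omega
    have h2 : ¬ 1 ≤ i := by omega
    simp [e, h1, h2]
  · simp [e, d, dMag, dTree, dVertex]
  · obtain ⟨j, rfl⟩ : ∃ j : ℕ, i = j + 1 := ⟨(i - 1).toNat, by omega⟩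
    have h1 : (0 : ℤ) ≤ j + 1 := by omega
    have h2 : ((j : ℤ) + 1).toNat = j + 1 := by omega
    simp [e, d, dMag, dTree, dVertex, act, h1, h2, BTree.map, perm21]

theorem act_act {n : ℕ} (σ τ : Equiv.Perm (Fin n)) (a : E n) :
    act τ (act σ a) = act (σ * τ) a := by
  apply Subtype.ext
  change Finsupp.mapDomain _ (Finsupp.mapDomain _ a.1) = Finsupp.mapDomain _ a.1
  rw [← Finsupp.mapDomain_comp]
  congr 1
  funext t
  simp [map_map, mul_inv_rev]

theorem eq_node_of_leaves {t : BTree (Fin 2)}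
    (ht : t.leaves = (Finset.univ : Finset (Fin 2)).val) :
    ∃ i, t = node i (leaf 0) (leaf 1) ∨ t = node i (leaf 1) (leaf 0) := by
  have hpos : ∀ s : BTree (Fin 2), 0 < s.leaves.card := fun s => by
    induction s with
    | leaf a => simp [leaves]
    | node i l r hl hr => simp only [leaves, Multiset.card_add]; omega
  have hc := congrArg Multiset.card ht
  cases t with
  | leaf a => simp [leaves] at hc
  | node i l r =>
    cases l with
    | node j l1 l2 =>
      have := hpos l1; have := hpos l2; have := hpos r
      simp [leaves] at hc; omega
    | leaf a =>
      cases r with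
      | node j l1 l2 =>
        have := hpos l1; have := hpos l2
        simp [leaves] at hc; omega
      | leaf b =>
        refine ⟨i, ?_⟩
        revert ht
        simp only [leaves]
        fin_cases a <;> fin_cases b <;> simp <;> decide

theorem linear_ext {S V : Type} [AddCommGroup V] [Module (ZMod 2) V] {P : Set S}
    {f g : (S →₀ ZMod 2) →ₗ[ZMod 2] V}
    (h : ∀ t ∈ P, f (Finsupp.single t 1) = g (Finsupp.single t 1)) {a : S →₀ ZMod 2}
    (ha : a ∈ Finsupp.supported (ZMod 2) (ZMod 2) P) : f a = g a := by
  rw [← Finsupp.sum_single a, map_finsuppSum, map_finsuppSum]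
  refine Finsupp.sum_congr fun t ht => ?_
  rw [← mul_one (a t), ← smul_eq_mul, ← Finsupp.smul_single, map_smul, map_smul, h t (ha ht)]

theorem swapRoot_op {α : Type} (i : ℕ) (a b : Mag α) :
    Finsupp.lmapDomain (ZMod 2) (ZMod 2) BTree.swapRoot (op i a b) = op i b a := by
  have h : (op (α := α) i).compr₂ (Finsupp.lmapDomain (ZMod 2) (ZMod 2) BTree.swapRoot)
      = (op i).flip := by
    ext l r : 4
    simp [op, BTree.swapRoot]
  exact LinearMap.congr_fun (LinearMap.congr_fun h a) b

theorem map_op {α β : Type} (f : α → β) (i : ℕ) (a b : Mag α) :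
    Finsupp.lmapDomain (ZMod 2) (ZMod 2) (BTree.map f) (op i a b)
      = op i (Finsupp.mapDomain (BTree.map f) a) (Finsupp.mapDomain (BTree.map f) b) := by
  have h : (op (α := α) i).compr₂ (Finsupp.lmapDomain (ZMod 2) (ZMod 2) (BTree.map f))
      = (op i).compl₁₂ (Finsupp.lmapDomain (ZMod 2) (ZMod 2) (BTree.map f))
          (Finsupp.lmapDomain (ZMod 2) (ZMod 2) (BTree.map f)) := by
    ext l r : 4
    simp [op, BTree.map]
  exact LinearMap.congr_fun (LinearMap.congr_fun h a) b

/-- `σ(τ, ν) · F = (σ · (21))(τ, ν)`. -/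
theorem flip_comp {m n : ℕ} (o : E 2) (a : E m) (b : E n) :
    flip (comp o a b) = comp (act perm21 o) a b := by
  apply Subtype.ext
  let f : Fin 2 → Mag (Fin (m + n)) := ![Finsupp.mapDomain (BTree.map (Fin.castAdd n)) a.1,
      Finsupp.mapDomain (BTree.map (Fin.natAdd m)) b.1]
  refine linear_ext (f := Finsupp.lmapDomain (ZMod 2) (ZMod 2) BTree.swapRoot ∘ₗ subst f)
    (g := subst f ∘ₗ Finsupp.lmapDomain (ZMod 2) (ZMod 2) (BTree.map ⇑perm21⁻¹))
    (fun t ht => ?_) o.2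
  obtain ⟨i, rfl | rfl⟩ := eq_node_of_leaves ht
  · simpa [subst, substTree, BTree.map, perm21] using swapRoot_op i (f 0) (f 1)
  · simpa [subst, substTree, BTree.map, perm21] using swapRoot_op i (f 1) (f 0)

/-- `(σ · (21))(τ, ν) = σ(ν, τ) · (3412)`. -/
theorem act_comp (o : E 2) (a b : E 2) :
    comp (act perm21 o) a b = act perm3412 (comp o b a) := by
  apply Subtype.ext
  let f : Fin 2 → Mag (Fin 4) := ![Finsupp.mapDomain (BTree.map (Fin.castAdd 2)) a.1,
      Finsupp.mapDomain (BTree.map (Fin.natAdd 2)) b.1]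
  let g : Fin 2 → Mag (Fin 4) := ![Finsupp.mapDomain (BTree.map (Fin.castAdd 2)) b.1,
      Finsupp.mapDomain (BTree.map (Fin.natAdd 2)) a.1]
  have h0 : Finsupp.mapDomain (BTree.map ⇑perm3412⁻¹) (g 0) = f 1 := by
    change Finsupp.mapDomain _ (Finsupp.mapDomain _ b.1) = Finsupp.mapDomain _ b.1
    rw [← Finsupp.mapDomain_comp]
    congr 1
    funext t
    rw [Function.comp_apply, map_map]
    congr 1
    decide
  have h1 : Finsupp.mapDomain (BTree.map ⇑perm3412⁻¹) (g 1) = f 0 := by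
    change Finsupp.mapDomain _ (Finsupp.mapDomain _ a.1) = Finsupp.mapDomain _ a.1
    rw [← Finsupp.mapDomain_comp]
    congr 1
    funext t
    rw [Function.comp_apply, map_map]
    congr 1
    decide
  refine linear_ext (f := subst f ∘ₗ Finsupp.lmapDomain (ZMod 2) (ZMod 2) (BTree.map ⇑perm21⁻¹))
    (g := Finsupp.lmapDomain (ZMod 2) (ZMod 2) (BTree.map ⇑perm3412⁻¹) ∘ₗ subst g)
    (fun t ht => ?_) o.2
  obtain ⟨i, rfl | rfl⟩ := eq_node_of_leaves ht
  · have := map_op (⇑perm3412⁻¹) i (g 0) (g 1)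
    rw [h0, h1] at this
    simpa [subst, substTree, BTree.map, perm21] using this.symm
  · have := map_op (⇑perm3412⁻¹) i (g 1) (g 0)
    rw [h0, h1] at this
    simpa [subst, substTree, BTree.map, perm21] using this.symm

theorem e_mem (i : ℤ) : e i ∈ homogeneous 2 (-i) := by
  unfold e
  split_ifs with h
  · refine Finsupp.single_mem_supported (M := ZMod 2) (ZMod 2) 1 ?_
    simp [weight, h]
  · exact Submodule.zero_mem _

theorem act_mem {n : ℕ} {k : ℤ} (σ : Equiv.Perm (Fin n)) {a : E n} (ha : a ∈ homogeneous n k) :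
    act σ a ∈ homogeneous n k := by
  change Finsupp.lmapDomain (ZMod 2) (ZMod 2) (BTree.map ⇑σ⁻¹) a.1 ∈ ofDegree k
  refine lmapDomain_mem (fun t ht => ?_) ha
  rw [Set.mem_ofPred_eq] at ht ⊢
  rw [weight_map, ht]

theorem substTree_mem_ofDegree {α β : Type} {f : α → Mag β} {k : α → ℤ}
    (hf : ∀ a, f a ∈ ofDegree (k a)) (t : BTree α) :
    substTree f t ∈ ofDegree (-(t.weight : ℤ) + (t.leaves.map k).sum) := by
  induction t with
  | leaf a => simpa [substTree, leaves, weight] using hf a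
  | node i l r hl hr =>
    have := op_mem_ofDegree i hl hr
    simp only [substTree, leaves, weight, Multiset.map_add, Multiset.sum_add]
    convert this using 2
    push_cast
    ring

theorem comp_mem {m n : ℕ} {i j k : ℤ} {o : E 2} {a : E m} {b : E n}
    (ho : o ∈ homogeneous 2 i) (ha : a ∈ homogeneous m j) (hb : b ∈ homogeneous n k) :
    comp o a b ∈ homogeneous (m + n) (i + j + k) := by
  let f : Fin 2 → Mag (Fin (m + n)) := ![Finsupp.mapDomain (BTree.map (Fin.castAdd n)) a.1,
      Finsupp.mapDomain (BTree.map (Fin.natAdd m)) b.1]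
  have hf : ∀ s, f s ∈ ofDegree (![j, k] s) := fun s => by
    fin_cases s
    · refine lmapDomain_mem (fun t ht => ?_) ha
      rw [Set.mem_ofPred_eq] at ht ⊢
      rw [weight_map, ht]; rfl
    · refine lmapDomain_mem (fun t ht => ?_) hb
      rw [Set.mem_ofPred_eq] at ht ⊢
      rw [weight_map, ht]; rfl
  change Finsupp.linearCombination (ZMod 2) (substTree f) o.1 ∈ ofDegree (i + j + k)
  refine linearCombination_mem (P := {t | t.leaves = (Finset.univ : Finset (Fin 2)).val} ∩
    {t | (t.weight : ℤ) = -i}) (fun t ht => ?_) (fun t ht => ⟨o.2 ht, ho ht⟩)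
  have h := substTree_mem_ofDegree hf t
  rw [show t.leaves = _ from ht.1, show (t.weight : ℤ) = -i from ht.2] at h
  have h2 : ((Finset.univ : Finset (Fin 2)).val.map ![j, k]).sum = j + k := by
    change ∑ s, ![j, k] s = _
    simp
  rwa [h2, neg_neg, ← add_assoc] at h

theorem u_mem (m : ℕ) (n x : ℤ) : u m n x ∈ homogeneous 4 (-n - x) := by
  have hx := act_mem (perm21 ^ (m - 1)) (e_mem x)
  unfold u
  split_ifs with h1 h2
  · exact Submodule.zero_mem _
  · subst h2
    convert comp_mem hx (e_mem 0) (e_mem 0) using 2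
    ring
  · refine Submodule.sum_mem _ fun i _ => Submodule.sum_mem _ fun δ _ =>
      Submodule.smul_mem _ _ (Submodule.add_mem _ (Submodule.smul_mem _ _ ?_)
        (Submodule.smul_mem _ _ ?_))
    · convert comp_mem hx (e_mem _) (e_mem _) using 2
      ring
    · convert comp_mem hx (e_mem _) (act_mem _ (e_mem _)) using 2
      ring

theorem α_mem (n p : ℤ) : α n p ∈ homogeneous 4 (-n) := by
  refine Submodule.add_mem _ (Submodule.sum_mem _ fun s _ => ?_)
    (Submodule.sum_mem _ fun s _ => act_mem _ ?_)
  · convert u_mem (s + 1) (s + p) (n - s - p) using 2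
    ring
  · convert u_mem (s + 1) (s + p + 1) (n - s - p - 1) using 2
    ring

end

end AdemCartan

/-! The double sum defining $[u^m_n]_x$ is a disguised sum over $a+b=n$. Put $a=2^{k+1}\delta-i$ and
$b=n-a$. Since $m<2^{k+1}$, binomial coefficients with lower index at most $m$ depend modulo 2 only
on the upper index modulo $2^{k+1}$, and $\binom{i+m}{m}\equiv\binom{-i-1}{m}\equiv\binom{a-1}{m}$.
Hence, with the convention $\binom{-1}{r}=1$, $[u^{m+1}_n]_x$ is the sum over $a+b=n$ of
$\binom{b-1}{m}\binom{a-1}{m+1}\,e_x(21)^m(e_a,e_b)$ and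
$\binom{b-1}{m}\binom{a}{m+1}\,e_x(21)^m(e_a,e_b\cdot(21))$; this is `u_succ_eq_biSum`.

The vanishing range and the value at $n=m$ can be read off from this form. The formula for
$d[u^{m+1}_{n+1}]_x$ follows from the Leibniz rule `d_comp` by comparing coefficients on the four
kinds of composites, where Pascal's rule suffices (`d_u_succ_succ`).

For $\alpha$, write $\alpha_{n,p}=U_{n,p}+U_{n,p+1}\cdot(3412)$ with $U$ the sum `uSum`. Summing the
formula for $d[u]$ over $s$, the two contributions of $F$ cancel (`d_uSum`), and $(3412)$ commutes
with $(2143)$ and $(4321)$. For $p<0$ only two terms survive, both with lower index 0, and they are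
equal. -/

namespace AdemCartan

open BTree

noncomputable section

/-! ### Binomial coefficients modulo 2 -/

/-- The binomial coefficient `(b - 1 choose r)` modulo `2`, with `(-1 choose r) = 1`. -/
def predChoose : ℕ → ℕ → ZMod 2
  | 0, _ => 1
  | b + 1, r => (b.choose r : ZMod 2)

@[simp] theorem predChoose_zero_right (b : ℕ) : predChoose b 0 = 1 := by
  cases b <;> simp [predChoose]

theorem zmod_two_add_self {V : Type} [AddCommGroup V] [Module (ZMod 2) V] (v : V) :
    v + v = 0 := by
  rw [← two_smul (ZMod 2) v, show (2 : ZMod 2) = 0 from rfl, zero_smul]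

theorem predChoose_succ_succ (b r : ℕ) :
    predChoose (b + 1) (r + 1) = predChoose b r + predChoose b (r + 1) := by
  cases b with
  | zero => simp [predChoose, zmod_two_add_self]
  | succ b => simp [predChoose, Nat.choose_succ_succ]

/-- From $j\binom{N}{j}=N\binom{N-1}{j-1}$ with $N=2^K\delta$: were the binomial odd, $2^K$ would
divide $j$. -/
theorem choose_mul_two_pow_eq_zero {K δ j : ℕ} (hj : 0 < j) (hjK : j < 2 ^ K) :
    (((2 ^ K * δ).choose j : ℕ) : ZMod 2) = 0 := by
  rw [ZMod.natCast_eq_zero_iff]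
  by_contra hodd
  obtain ⟨j, rfl⟩ : ∃ l, j = l + 1 := ⟨j - 1, by omega⟩
  rcases Nat.eq_zero_or_pos (2 ^ K * δ) with h | h
  · exact hodd (by simp [h])
  obtain ⟨q, hq⟩ : ∃ q, 2 ^ K * δ = q + 1 := ⟨2 ^ K * δ - 1, by omega⟩
  rw [hq] at hodd
  have hdvd : 2 ^ K ∣ (q + 1).choose (j + 1) * (j + 1) := by
    rw [← Nat.add_one_mul_choose_eq, ← hq, mul_assoc]
    exact dvd_mul_right _ _
  have hcop : Nat.Coprime (2 ^ K) ((q + 1).choose (j + 1)) :=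
    Nat.Coprime.pow_left _ ((Nat.Prime.coprime_iff_not_dvd Nat.prime_two).2 hodd)
  exact absurd (Nat.le_of_dvd hj (hcop.dvd_of_dvd_mul_left hdvd)) (by omega)

theorem predChoose_mul_two_pow {K δ r : ℕ} (hr : r < 2 ^ K) :
    predChoose (2 ^ K * δ) r = 1 := by
  induction r with
  | zero => simp
  | succ r ih =>
    have h := predChoose_succ_succ (2 ^ K * δ) r
    rw [ih (by omega), predChoose, choose_mul_two_pow_eq_zero (by omega) hr] at h
    generalize predChoose (2 ^ K * δ) (r + 1) = c at h ⊢
    revert h c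
    decide

/-- Periodicity in the upper index. Both sides obey Pascal's rule, and they agree at $b=0$, which is
where the convention $\binom{-1}{r}=1$ is needed. -/
theorem predChoose_add_mul_two_pow {K δ r : ℕ} (b : ℕ) (hr : r < 2 ^ K) :
    predChoose (b + 2 ^ K * δ) r = predChoose b r := by
  induction b generalizing r with
  | zero => rw [zero_add, predChoose_mul_two_pow hr, predChoose]
  | succ b ih =>
    cases r with
    | zero => simp
    | succ r =>
      rw [add_right_comm, predChoose_succ_succ, predChoose_succ_succ, ih hr, ih (by omega)]

/-- Reflection of the upper index modulo a large power of `2`. -/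
theorem choose_eq_predChoose {K δ i a m : ℕ} (h : a + i = 2 ^ K * δ) (hm : m < 2 ^ K) :
    (((i + m).choose m : ℕ) : ZMod 2) = predChoose a m := by
  -- Raising $i$ lowers $a$; both sides obey the same Pascal recursion in $(i,m)$, with boundary
  -- values 1.
  induction i generalizing a m with
  | zero =>
    rw [add_zero] at h
    simp [h, predChoose_mul_two_pow hm]
  | succ i ihi =>
    induction m with
    | zero => simp
    | succ m ihm =>
      have h1 := ihi (a := a + 1) (by omega) hm
      rw [predChoose_succ_succ, ← ihm (by omega)] at h1
      rw [show i + 1 + (m + 1) = (i + 1 + m) + 1 by ring, Nat.choose_succ_succ, Nat.cast_add,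
        show i + 1 + m = i + (m + 1) by ring] at *
      rw [h1, ← add_assoc, zmod_two_add_self, zero_add]

theorem may_natCast (i j : ℕ) : may i j = (((i + j).choose j : ℕ) : ZMod 2) := by
  rw [may, if_pos (by omega), Nat.add_choose]
  norm_cast

theorem may_of_add_eq {K δ i a m : ℕ} (h : a + i = 2 ^ K * δ) (hm : m < 2 ^ K) :
    may i m = predChoose a m := by
  rw [may_natCast, choose_eq_predChoose h hm]

theorem may_sub_one_of_add_eq {K δ i a m : ℕ} (h : a + i = 2 ^ K * δ) (hm0 : 0 < m)
    (hm : m < 2 ^ K) : may (i - 1) m = predChoose (a + 1) m := by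
  cases i with
  | zero =>
    -- The symbol $(-1,m)$ is 0 by convention, matching $\binom{2^K\delta}{m}\equiv 0$ for
    -- $0<m<2^K$.
    rw [may, if_neg (by simp), predChoose, show a = 2 ^ K * δ from h,
      choose_mul_two_pow_eq_zero hm0 hm]
  | succ i =>
    rw [Nat.cast_succ, add_sub_cancel_right, may_of_add_eq (a := a + 1) (δ := δ) (by omega) hm]

theorem may_sub_add_of_add_eq {K δ i a b m : ℕ} (h : a + i = 2 ^ K * δ) (hn : 0 < a + b)
    (hm : m < 2 ^ K) :
    may (((a + b : ℕ) : ℤ) - (m + 1 : ℕ) + i) ((m + 1 : ℕ) - 1) = predChoose b m := by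
  -- Here $q=a+b+i-1$, the upper index of the binomial behind the symbol. It is a natural number
  -- because $a+b>0$.
  obtain ⟨q, hq⟩ : ∃ q, b + 2 ^ K * δ = q + 1 := ⟨b + 2 ^ K * δ - 1, by omega⟩
  rw [← predChoose_add_mul_two_pow (δ := δ) b hm, hq, predChoose,
    show (((m + 1 : ℕ) : ℤ) - 1) = (m : ℕ) by push_cast; ring]
  rcases le_or_gt m q with hmq | hmq
  · rw [show (((a + b : ℕ) : ℤ) - (m + 1 : ℕ) + i) = ((q - m : ℕ) : ℤ) by omega, may_natCast,
      Nat.sub_add_cancel hmq]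
  · rw [may, if_neg (by omega), Nat.choose_eq_zero_of_lt hmq, Nat.cast_zero]

/-! ### Operadic composition and the differential -/

/-- Identities additive in the root need checking only on the basis $e_i$, $e_i\cdot(21)$ of
$\mathcal E(2)$; over $\mathbb F_2$ scalars impose no further condition. -/
theorem E_two_induction {P : E 2 → Prop} (zero : P 0) (add : ∀ a b, P a → P b → P (a + b))
    (gen : ∀ i : ℕ, P (e i)) (gen_swap : ∀ i : ℕ, P (act perm21 (e i))) (o : E 2) : P o := by
  have key : ∀ a : Mag (Fin 2), a ∈ Submodule.span (ZMod 2) ((fun t => Finsupp.single t 1) ''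
      {t : BTree (Fin 2) | t.leaves = (Finset.univ : Finset (Fin 2)).val}) →
      ∃ h : a ∈ E 2, P ⟨a, h⟩ := by
    intro a ha
    induction ha using Submodule.span_induction with
    | mem x hx =>
      obtain ⟨t, ht, rfl⟩ := hx
      obtain ⟨i, rfl | rfl⟩ := eq_node_of_leaves ht
      · refine ⟨Finsupp.single_mem_supported _ _ ht, ?_⟩
        convert gen i
        simp [e]
      · refine ⟨Finsupp.single_mem_supported _ _ ht, ?_⟩
        convert gen_swap i
        refine Subtype.ext (Eq.symm ?_)
        change Finsupp.lmapDomain (ZMod 2) (ZMod 2) _ (e i).1 = _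
        simp [e, BTree.map, perm21]
    | zero => exact ⟨Submodule.zero_mem _, zero⟩
    | add x y _ _ hx hy =>
      obtain ⟨hx, hx'⟩ := hx
      obtain ⟨hy, hy'⟩ := hy
      exact ⟨Submodule.add_mem _ hx hy, add _ _ hx' hy'⟩
    | smul c x _ hx =>
      obtain ⟨hx, hx'⟩ := hx
      refine ⟨Submodule.smul_mem _ _ hx, ?_⟩
      fin_cases c
      · convert zero
        exact zero_smul (ZMod 2) x
      · convert hx'
        exact one_smul (ZMod 2) x
  refine (key o.1 ?_).2
  rw [← Finsupp.supported_eq_span_single]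
  exact o.2

section Comp

variable {m n : ℕ}

theorem comp_e (i : ℕ) (a : E m) (b : E n) : (comp (e i) a b).1 =
    op i (Finsupp.mapDomain (BTree.map (Fin.castAdd n)) a.1)
      (Finsupp.mapDomain (BTree.map (Fin.natAdd m)) b.1) := by
  simp [comp, e, subst, substTree]

theorem comp_act_e (i : ℕ) (a : E m) (b : E n) : (comp (act perm21 (e i)) a b).1 =
    op i (Finsupp.mapDomain (BTree.map (Fin.natAdd m)) b.1)
      (Finsupp.mapDomain (BTree.map (Fin.castAdd n)) a.1) := by
  simp [comp, e, act, subst, substTree, BTree.map, perm21]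

theorem comp_add_root (o o' : E 2) (a : E m) (b : E n) :
    comp (o + o') a b = comp o a b + comp o' a b :=
  Subtype.ext (map_add (subst _) o.1 o'.1)

@[simp] theorem comp_zero_root (a : E m) (b : E n) : comp 0 a b = 0 :=
  Subtype.ext (map_zero (subst _))

theorem comp_add_left (o : E 2) (a a' : E m) (b : E n) :
    comp o (a + a') b = comp o a b + comp o a' b := by
  induction o using E_two_induction with
  | zero => simp
  | add o o' h h' => simp only [comp_add_root, h, h']; abel
  | gen i => exact Subtype.ext (by simp [comp_e, Finsupp.mapDomain_add])
  | gen_swap i => exact Subtype.ext (by simp [comp_act_e, Finsupp.mapDomain_add])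

theorem comp_add_right (o : E 2) (a : E m) (b b' : E n) :
    comp o a (b + b') = comp o a b + comp o a b' := by
  induction o using E_two_induction with
  | zero => simp
  | add o o' h h' => simp only [comp_add_root, h, h']; abel
  | gen i => exact Subtype.ext (by simp [comp_e, Finsupp.mapDomain_add])
  | gen_swap i => exact Subtype.ext (by simp [comp_act_e, Finsupp.mapDomain_add])

@[simp] theorem comp_zero_left (o : E 2) (b : E n) : comp o (0 : E m) b = 0 := by
  simpa using comp_add_left o (0 : E m) 0 b

@[simp] theorem comp_zero_right (o : E 2) (a : E m) : comp o a (0 : E n) = 0 := by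
  simpa using comp_add_right o a (0 : E n) 0

end Comp

theorem dTree_map {α β : Type} (f : α → β) (t : BTree α) :
    dTree (t.map f) = Finsupp.mapDomain (BTree.map f) (dTree t) := by
  induction t with
  | leaf a => simp [BTree.map, dTree]
  | node i l r hl hr =>
    have h1 := map_op f i (dTree l) (Finsupp.single r 1)
    have h2 := map_op f i (Finsupp.single l 1) (dTree r)
    simp only [Finsupp.lmapDomain_apply, Finsupp.mapDomain_single] at h1 h2
    have h0 : dVertex (l.map f) (r.map f) i
        = Finsupp.mapDomain (BTree.map f) (dVertex l r i) := by
      cases i <;> simp [dVertex, Finsupp.mapDomain_add, BTree.map]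
    simp only [BTree.map, dTree, hl, hr, Finsupp.mapDomain_add, h1, h2, h0]

theorem dMag_mapDomain {α β : Type} (f : α → β) (a : Mag α) :
    dMag (Finsupp.mapDomain (BTree.map f) a) = Finsupp.mapDomain (BTree.map f) (dMag a) := by
  have h : dMag ∘ₗ Finsupp.lmapDomain (ZMod 2) (ZMod 2) (BTree.map f)
      = Finsupp.lmapDomain (ZMod 2) (ZMod 2) (BTree.map f) ∘ₗ dMag := by
    ext t : 2
    simp [dMag, dTree_map]
  exact LinearMap.congr_fun h a

theorem dMag_op_zero {α : Type} (a b : Mag α) :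
    dMag (op 0 a b) = op 0 (dMag a) b + op 0 a (dMag b) := by
  have h : (op (α := α) 0).compr₂ dMag
      = (op 0).compl₁₂ dMag LinearMap.id + (op 0).compl₁₂ LinearMap.id dMag := by
    ext l r : 4
    simp [op_single, dMag, dTree, dVertex]
  exact LinearMap.congr_fun (LinearMap.congr_fun h a) b

theorem dMag_op_succ {α : Type} (i : ℕ) (a b : Mag α) :
    dMag (op (i + 1) a b)
      = op i a b + op i b a + op (i + 1) (dMag a) b + op (i + 1) a (dMag b) := by
  have h : (op (α := α) (i + 1)).compr₂ dMag
      = op i + (op i).flip + (op (i + 1)).compl₁₂ dMag LinearMap.id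
        + (op (i + 1)).compl₁₂ LinearMap.id dMag := by
    ext l r : 4
    simp [op_single, dMag, dTree, dVertex]
  exact LinearMap.congr_fun (LinearMap.congr_fun h a) b

theorem d_act {n : ℕ} (σ : Equiv.Perm (Fin n)) (a : E n) : d (act σ a) = act σ (d a) :=
  Subtype.ext (dMag_mapDomain _ a.1)

theorem coe_d {n : ℕ} (a : E n) : (d a).1 = dMag a.1 := rfl

theorem act_perm21_act_perm21 (a : E 2) : act perm21 (act perm21 a) = a := by
  rw [act_act, show perm21 * perm21 = 1 by decide]
  apply Subtype.ext
  change Finsupp.mapDomain (BTree.map id) a.1 = a.1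
  convert Finsupp.mapDomain_id
  funext t
  induction t with
  | leaf a => rfl
  | node i l r hl hr => simp [BTree.map, hl, hr]

/-- The Leibniz rule for operadic composition. -/
theorem d_comp {m n : ℕ} (o : E 2) (a : E m) (b : E n) :
    d (comp o a b) = comp (d o) a b + comp o (d a) b + comp o a (d b) := by
  induction o using E_two_induction with
  | zero => simp
  | add o o' h h' => simp only [comp_add_root, map_add, h, h']; abel
  | gen i =>
    rw [d_e, comp_add_root]
    apply Subtype.ext
    cases i with
    | zero =>
      rw [show e (((0 : ℕ) : ℤ) - 1) = 0 by simp [e]]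
      simp only [map_zero, comp_zero_root, zero_add, Submodule.coe_add, comp_e, coe_d,
        dMag_op_zero, dMag_mapDomain]
    | succ i =>
      simp only [Nat.cast_succ, add_sub_cancel_right, Submodule.coe_add, comp_act_e, comp_e,
        coe_d]
      rw [show ((i : ℤ) + 1) = ((i + 1 : ℕ) : ℤ) by simp]
      simp only [comp_e, dMag_op_succ, dMag_mapDomain, coe_d]
  | gen_swap i =>
    rw [d_act, d_e, map_add, act_perm21_act_perm21, comp_add_root]
    apply Subtype.ext
    cases i with
    | zero =>
      rw [show e (((0 : ℕ) : ℤ) - 1) = 0 by simp [e], add_right_comm]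
      simp only [map_zero, comp_zero_root, add_zero, Submodule.coe_add, comp_act_e, coe_d,
        dMag_op_zero, dMag_mapDomain]
      abel
    | succ i =>
      simp only [Nat.cast_succ, add_sub_cancel_right, Submodule.coe_add, comp_act_e, comp_e,
        coe_d]
      rw [show ((i : ℤ) + 1) = ((i + 1 : ℕ) : ℤ) by simp]
      simp only [comp_act_e, dMag_op_succ, dMag_mapDomain, coe_d]
      abel

theorem act_perm2143_comp (o a b : E 2) :
    act perm2143 (comp o a b) = comp o (act perm21 a) (act perm21 b) := by
  have hl : ∀ c : Mag (Fin 2), Finsupp.mapDomain (BTree.map ⇑perm2143⁻¹)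
      (Finsupp.mapDomain (BTree.map (Fin.castAdd 2)) c)
      = Finsupp.mapDomain (BTree.map (Fin.castAdd 2))
        (Finsupp.mapDomain (BTree.map ⇑perm21⁻¹) c) := fun c => by
    rw [← Finsupp.mapDomain_comp, ← Finsupp.mapDomain_comp]
    congr 1
    funext t
    simp only [Function.comp_apply, map_map]
    congr 1
    decide
  have hr : ∀ c : Mag (Fin 2), Finsupp.mapDomain (BTree.map ⇑perm2143⁻¹)
      (Finsupp.mapDomain (BTree.map (Fin.natAdd 2)) c)
      = Finsupp.mapDomain (BTree.map (Fin.natAdd 2))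
        (Finsupp.mapDomain (BTree.map ⇑perm21⁻¹) c) := fun c => by
    rw [← Finsupp.mapDomain_comp, ← Finsupp.mapDomain_comp]
    congr 1
    funext t
    simp only [Function.comp_apply, map_map]
    congr 1
    decide
  induction o using E_two_induction with
  | zero => simp
  | add o o' h h' => simp only [comp_add_root, map_add, h, h']
  | gen i =>
    apply Subtype.ext
    change Finsupp.lmapDomain (ZMod 2) (ZMod 2) _ (comp (e i) a b).1 = _
    rw [comp_e, comp_e, map_op, hl, hr]
    rfl
  | gen_swap i =>
    apply Subtype.ext
    change Finsupp.lmapDomain (ZMod 2) (ZMod 2) _ (comp (act perm21 (e i)) a b).1 = _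
    rw [comp_act_e, comp_act_e, map_op, hl, hr]
    rfl

/-- $(4321)$ is the product of $(2143)$ and $(3412)$: the first acts inside the two branches, the
second exchanges them and twists the root. -/
theorem act_perm4321_comp (o a b : E 2) : act perm4321 (comp o a b)
    = comp (act perm21 o) (act perm21 b) (act perm21 a) := by
  rw [act_comp, ← act_perm2143_comp, act_act]
  congr 2
  decide

theorem e_of_neg {i : ℤ} (h : i < 0) : e i = 0 := by
  rw [e, if_neg (by omega)]

theorem act_perm21_pow_succ (r : ℕ) (a : E 2) :
    act perm21 (act (perm21 ^ r) a) = act (perm21 ^ (r + 1)) a := by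
  rw [act_act, pow_succ]

/-! ### Sums of composites over $a+b=n$ -/

/-- The combination of the operations `o(e_a, e_b)` and `o(e_a, e_b·(21))`, `a + b = n`, with
coefficients `A a b` and `B a b`. -/
def biSum (o : E 2) (A B : ℕ → ℕ → ZMod 2) (n : ℕ) : E 4 :=
  ∑ p ∈ Finset.HasAntidiagonal.antidiagonal n,
    (A p.1 p.2 • comp o (e p.1) (e p.2) + B p.1 p.2 • comp o (e p.1) (act perm21 (e p.2)))

section BiSum

theorem d_comp_two (o a b : E 2) :
    d (n := 4) (comp o a b) = comp (d o) a b + comp o (d a) b + comp o a (d b) :=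
  d_comp o a b

variable (o o' : E 2) (A B : ℕ → ℕ → ZMod 2) (n : ℕ)

theorem biSum_add_root : biSum (o + o') A B n = biSum o A B n + biSum o' A B n := by
  simp only [biSum, ← Finset.sum_add_distrib]
  refine Finset.sum_congr rfl fun p _ => ?_
  simp only [comp_add_root]
  module

theorem flip_biSum : flip (biSum o A B n) = biSum (act perm21 o) A B n := by
  simp only [biSum, map_sum, map_add, map_smul, ← flip_comp]

theorem act_perm2143_biSum : act perm2143 (biSum o A B n) =
    ∑ p ∈ Finset.HasAntidiagonal.antidiagonal n,
      (A p.1 p.2 • comp o (act perm21 (e p.1)) (act perm21 (e p.2))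
        + B p.1 p.2 • comp o (act perm21 (e p.1)) (e p.2)) := by
  simp only [biSum, map_sum, map_add, map_smul, act_perm2143_comp, act_perm21_act_perm21]

theorem act_perm4321_biSum : act perm4321 (biSum o A B n) =
    ∑ p ∈ Finset.HasAntidiagonal.antidiagonal n,
      (A p.2 p.1 • comp (act perm21 o) (act perm21 (e p.1)) (act perm21 (e p.2))
        + B p.2 p.1 • comp (act perm21 o) (e p.1) (act perm21 (e p.2))) := by
  simp only [biSum, map_sum, map_add, map_smul, act_perm4321_comp, act_perm21_act_perm21]
  rw [← Finset.Nat.sum_antidiagonal_swap]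
  rfl

theorem d_biSum_zero : d (biSum o A B 0) = biSum (d o) A B 0 := by
  simp [biSum, d_comp_two, d_act, d_e, e_of_neg]

theorem d_biSum_succ : d (biSum o A B (n + 1)) = biSum (d o) A B (n + 1)
    + ∑ p ∈ Finset.HasAntidiagonal.antidiagonal n,
      ((A (p.1 + 1) p.2 + A p.1 (p.2 + 1) + B p.1 (p.2 + 1)) • comp o (e p.1) (e p.2)
        + (A p.1 (p.2 + 1) + B (p.1 + 1) p.2 + B p.1 (p.2 + 1)) •
          comp o (e p.1) (act perm21 (e p.2))
        + A (p.1 + 1) p.2 • comp o (act perm21 (e p.1)) (e p.2)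
        + B (p.1 + 1) p.2 • comp o (act perm21 (e p.1)) (act perm21 (e p.2))) := by
  have hsplit : d (biSum o A B (n + 1)) = biSum (d o) A B (n + 1)
      + ∑ p ∈ Finset.HasAntidiagonal.antidiagonal (n + 1),
        (A p.1 p.2 • comp o (d (e p.1)) (e p.2)
          + B p.1 p.2 • comp o (d (e p.1)) (act perm21 (e p.2)))
      + ∑ p ∈ Finset.HasAntidiagonal.antidiagonal (n + 1),
        (A p.1 p.2 • comp o (e p.1) (d (e p.2))
          + B p.1 p.2 • comp o (e p.1) (act perm21 (d (e p.2)))) := by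
    simp only [biSum, map_sum, map_add, map_smul, d_comp_two, d_act, ← Finset.sum_add_distrib]
    refine Finset.sum_congr rfl fun p _ => ?_
    module
  -- Terms differentiating $e_0$ vanish since $e_{-1}=0$, so both sums reindex over $a+b=n$.
  rw [hsplit, Finset.Nat.sum_antidiagonal_succ, Finset.Nat.sum_antidiagonal_succ', add_assoc]
  congr 1
  simp only [d_e, Nat.cast_zero, zero_sub, e_of_neg neg_one_lt_zero, map_zero, add_zero,
    comp_zero_left, comp_zero_right, smul_zero, zero_add, Nat.cast_succ, add_sub_cancel_right,
    ← Finset.sum_add_distrib]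
  refine Finset.sum_congr rfl fun p _ => ?_
  simp only [map_add, act_perm21_act_perm21, comp_add_left, comp_add_right]
  module

end BiSum

/-! ### The elements $[u^m_n]_x$ -/

@[simp] theorem u_zero (n x : ℤ) : u 0 n x = 0 := by simp [u]

theorem u_of_neg {m : ℕ} {n x : ℤ} (hn : n < 0) : u m n x = 0 := by
  unfold u
  split_ifs with h1 h2
  · rfl
  · omega
  · refine Finset.sum_eq_zero fun i _ => Finset.sum_eq_zero fun δ hδ => ?_
    have := (Finset.mem_filter.1 hδ).2
    omega

theorem u_root_of_neg {m : ℕ} {n x : ℤ} (hx : x < 0) : u m n x = 0 := by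
  simp [u, e_of_neg hx]

/-- The coefficients of `[u^m_n]_x` are binomial coefficients in the two degrees. -/
theorem u_succ_eq_biSum (m n : ℕ) (x : ℤ) : u (m + 1) n x =
    biSum (act (perm21 ^ m) (e x)) (fun a b => predChoose b m * predChoose a (m + 1))
      (fun a b => predChoose b m * predChoose (a + 1) (m + 1)) n := by
  rcases Nat.eq_zero_or_pos n with rfl | hn
  -- The separately defined case $n=0$ fits the general form: at $a=b=0$ the convention gives
  -- coefficients 1 and $\binom{0}{m+1}=0$.
  · simp [u, biSum, predChoose]
  rw [u, if_neg (by omega), if_neg (by omega), biSum]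
  have hmK := Nat.lt_pow_succ_log_self one_lt_two (m + 1)
  rw [Nat.succ_eq_add_one] at hmK
  generalize Nat.log 2 (m + 1) + 1 = K at *
  have hQ : (0 : ℤ) < 2 ^ K := by positivity
  rw [Finset.sum_sigma']
  refine Finset.sum_bij
    (fun s _ => ((2 ^ K * s.2 - s.1).toNat, (n + s.1 - 2 ^ K * s.2).toNat)) ?_ ?_ ?_ ?_
  · rintro ⟨i, δ⟩ hs
    simp only [Finset.mem_sigma, Finset.mem_range, Finset.mem_filter] at hs
    rw [Finset.HasAntidiagonal.mem_antidiagonal]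
    dsimp only
    omega
  · rintro ⟨i, δ⟩ hs ⟨i', δ'⟩ hs' h
    simp only [Finset.mem_sigma, Finset.mem_range, Finset.mem_filter] at hs hs'
    simp only [Prod.mk.injEq] at h
    have hi : (i : ℤ) < 2 ^ K := by exact_mod_cast hs.1
    have hi' : (i' : ℤ) < 2 ^ K := by exact_mod_cast hs'.1
    have hδ : δ = δ' := by
      rcases lt_trichotomy δ δ' with hlt | heq | hlt
      · have := mul_le_mul_of_nonneg_left (Int.add_one_le_of_lt hlt) hQ.le
        rw [mul_add, mul_one] at this
        omega
      · exact heq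
      · have := mul_le_mul_of_nonneg_left (Int.add_one_le_of_lt hlt) hQ.le
        rw [mul_add, mul_one] at this
        omega
    subst hδ
    obtain rfl : i = i' := by omega
    rfl
  -- The preimage comes from dividing $-a$ by $2^K$: $i$ is the remainder and $\delta$ is minus the
  -- quotient.
  · rintro ⟨a, b⟩ hab
    rw [Finset.HasAntidiagonal.mem_antidiagonal] at hab
    dsimp only at hab
    have h0 := Int.emod_nonneg (-(a : ℤ)) hQ.ne'
    have h1 := Int.emod_lt_of_pos (-(a : ℤ)) hQ
    have h2 := Int.emod_add_mul_ediv (-(a : ℤ)) (2 ^ K)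
    obtain ⟨i, hi⟩ := Int.eq_ofNat_of_zero_le h0
    rw [hi] at h1 h2
    obtain ⟨δ, hδ⟩ : ∃ δ, δ = -(-(a : ℤ) / 2 ^ K) := ⟨_, rfl⟩
    have h3 : 2 ^ K * δ = a + i := by rw [hδ, mul_neg]; omega
    have h4 : 0 ≤ δ := by
      by_contra! h
      have := mul_neg_of_pos_of_neg hQ h
      omega
    have h5 : δ ≤ 2 ^ K * δ := le_mul_of_one_le_left h4 hQ
    refine ⟨⟨i, δ⟩, ?_, ?_⟩
    · simp only [Finset.mem_sigma, Finset.mem_range, Finset.mem_filter, Finset.mem_Icc]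
      exact ⟨by exact_mod_cast h1, by omega⟩
    · simp only [Prod.mk.injEq]
      omega
  · rintro ⟨i, δ⟩ hs
    simp only [Finset.mem_sigma, Finset.mem_range, Finset.mem_filter, Finset.mem_Icc] at hs ⊢
    obtain ⟨hi, ⟨hδ, -⟩, h0, hle⟩ := hs
    lift δ to ℕ using hδ
    obtain ⟨a, ha⟩ := Int.eq_ofNat_of_zero_le h0
    obtain ⟨b, hb⟩ := Int.eq_ofNat_of_zero_le (sub_nonneg.2 hle)
    have hai : a + i = 2 ^ K * δ := by zify; omega
    have hbn : (n : ℤ) + i - 2 ^ K * δ = b := by omega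
    obtain rfl : n = a + b := by omega
    rw [ha, hbn, Int.toNat_natCast, Int.toNat_natCast, may_sub_add_of_add_eq hai hn (by omega),
      may_of_add_eq hai hmK, may_sub_one_of_add_eq hai (by omega) hmK, smul_add, smul_smul,
      smul_smul, Nat.add_sub_cancel]

/-- `predChoose` with lower index lowered by `1`. -/
def predChoosePred (b : ℕ) : ℕ → ZMod 2
  | 0 => 0
  | m + 1 => predChoose b m

theorem predChoose_succ (b m : ℕ) :
    predChoose (b + 1) m = predChoose b m + predChoosePred b m := by
  cases m with
  | zero => simp [predChoosePred]
  | succ m => rw [predChoose_succ_succ, add_comm, predChoosePred]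

theorem predChoosePred_succ (b m : ℕ) : predChoosePred b (m + 1) = predChoose b m := rfl

/-- $F$ turns the root $e_x(21)^{m-1}$ of $[u^m_n]_x$ into $e_x(21)^m$, the root of $[u^{m+1}_n]_x$,
so coefficients become comparable. `predChoosePred` being 0 at $m=0$ covers $[u^0_n]_x=0$. -/
theorem flip_u (m n : ℕ) (x : ℤ) : flip (u m n x) =
    biSum (act (perm21 ^ m) (e x)) (fun a b => predChoosePred b m * predChoose a m)
      (fun a b => predChoosePred b m * predChoose (a + 1) m) n := by
  cases m with
  | zero => simp [biSum, predChoosePred]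
  | succ m => rw [u_succ_eq_biSum, flip_biSum, act_perm21_pow_succ]; rfl

theorem act_perm4321_u (m n : ℕ) (x : ℤ) : act perm4321 (u m n x) =
    ∑ p ∈ Finset.HasAntidiagonal.antidiagonal n,
      ((predChoosePred p.1 m * predChoose p.2 m) •
          comp (act (perm21 ^ m) (e x)) (act perm21 (e p.1)) (act perm21 (e p.2))
        + (predChoosePred p.1 m * predChoose (p.2 + 1) m) •
          comp (act (perm21 ^ m) (e x)) (e p.1) (act perm21 (e p.2))) := by
  cases m with
  | zero => simp [predChoosePred]
  | succ m => rw [u_succ_eq_biSum, act_perm4321_biSum, act_perm21_pow_succ]; rfl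

theorem biSum_d_root (m n : ℕ) (x : ℤ) (A B : ℕ → ℕ → ZMod 2) :
    biSum (d (act (perm21 ^ m) (e x))) A B n =
      biSum (act (perm21 ^ m) (e (x - 1))) A B n
        + flip (biSum (act (perm21 ^ m) (e (x - 1))) A B n) := by
  rw [flip_biSum, ← biSum_add_root, d_act, d_e, map_add, act_act, act_act, ← pow_succ,
    ← pow_succ']

theorem d_u_succ_succ (m n : ℕ) (x : ℤ) : d (u (m + 1) (n + 1 : ℕ) x) =
    (u (m + 1) n x + act perm2143 (u (m + 1) n x))
      + (flip (u m n x) + act perm4321 (u m n x))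
      + (u (m + 1) (n + 1 : ℕ) (x - 1) + flip (u (m + 1) (n + 1 : ℕ) (x - 1))) := by
  rw [u_succ_eq_biSum, u_succ_eq_biSum, u_succ_eq_biSum, d_biSum_succ, biSum_d_root,
    act_perm2143_biSum, flip_u, act_perm4321_u, add_comm]
  congr 1
  simp only [biSum, ← Finset.sum_add_distrib]
  refine Finset.sum_congr rfl fun p _ => ?_
  obtain ⟨a, b⟩ := p
  dsimp only
  -- The three identities compare coefficients of $(e_a,e_b)$, $(e_a,e_b\cdot(21))$ and
  -- $(e_a\cdot(21),e_b\cdot(21))$; those of $(e_a\cdot(21),e_b)$ agree outright. Pascal's rule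
  -- reduces each to a polynomial identity in free variables over $\mathbb F_2$.
  have h1 : predChoose b m * predChoose (a + 1) (m + 1)
        + predChoose (b + 1) m * predChoose a (m + 1)
        + predChoose (b + 1) m * predChoose (a + 1) (m + 1)
      = predChoose b m * predChoose a (m + 1) + predChoosePred b m * predChoose a m := by
    simp only [predChoose_succ, predChoosePred_succ]
    clear * -
    generalize predChoose b m = v₁, predChoosePred b m = v₂, predChoose a m = v₃,
      predChoose a (m + 1) = v₄
    decide +revert
  have h2 : predChoose (b + 1) m * predChoose a (m + 1)
        + predChoose b m * predChoose (a + 1 + 1) (m + 1)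
        + predChoose (b + 1) m * predChoose (a + 1) (m + 1)
      = predChoose b m * predChoose (a + 1) (m + 1)
        + predChoosePred b m * predChoose (a + 1) m
        + predChoosePred a m * predChoose (b + 1) m := by
    simp only [predChoose_succ, predChoosePred_succ]
    clear * -
    generalize predChoose b m = v₁, predChoosePred b m = v₂, predChoose a m = v₃,
      predChoose a (m + 1) = v₄, predChoosePred a m = v₅
    decide +revert
  have h3 : predChoose b m * predChoose (a + 1 + 1) (m + 1)
      = predChoose b m * predChoose a (m + 1) + predChoosePred a m * predChoose b m := by
    simp only [predChoose_succ, predChoosePred_succ]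
    clear * -
    generalize predChoose b m = v₁, predChoose a m = v₃,
      predChoose a (m + 1) = v₄, predChoosePred a m = v₅
    decide +revert
  rw [h1, h2, h3]
  module

theorem d_u (m : ℕ) (n x : ℤ) : d (u (m + 1) (n + 1) x) =
    (u (m + 1) n x + act perm2143 (u (m + 1) n x))
      + (flip (u m n x) + act perm4321 (u m n x))
      + (u (m + 1) (n + 1) (x - 1) + flip (u (m + 1) (n + 1) (x - 1))) := by
  rcases le_or_gt 0 n with hn | hn
  · lift n to ℕ using hn
    exact d_u_succ_succ m n x
  rw [u_of_neg hn, u_of_neg hn]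
  -- For $n=-1$ the element differentiated is $[u^{m+1}_0]_x$, where only the root contributes.
  rcases eq_or_ne n (-1) with rfl | hn'
  · have h : ∀ y, u (m + 1) (-1 + 1) y = u (m + 1) (0 : ℕ) y := fun y => rfl
    rw [h, h, u_succ_eq_biSum, u_succ_eq_biSum, d_biSum_zero, biSum_d_root]
    simp
  · rw [u_of_neg (by omega), u_of_neg (by omega)]
    simp

/-- With upper index $m+1$ and $a+b=n\le m$: $\binom{a}{m+1}=0$, while $\binom{b-1}{m}\ne0$ forces
$b=0$, and then $\binom{a-1}{m+1}=0$ because $a>0$. -/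
theorem u_eq_zero {m : ℕ} {n x : ℤ} (h0 : 0 < n) (hn : n < m) : u m n x = 0 := by
  obtain ⟨m, rfl⟩ : ∃ l, m = l + 1 := ⟨m - 1, by omega⟩
  lift n to ℕ using h0.le
  rw [u_succ_eq_biSum, biSum]
  refine Finset.sum_eq_zero fun p hp => ?_
  rw [Finset.HasAntidiagonal.mem_antidiagonal] at hp
  obtain ⟨a, b⟩ := p
  dsimp only at hp ⊢
  have h1 : predChoose (a + 1) (m + 1) = 0 := by
    rw [predChoose, Nat.choose_eq_zero_of_lt (by omega), Nat.cast_zero]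
  have h2 : predChoose b m * predChoose a (m + 1) = 0 := by
    cases b with
    | zero =>
      obtain ⟨a, rfl⟩ : ∃ l, a = l + 1 := ⟨a - 1, by omega⟩
      simp [predChoose, Nat.choose_eq_zero_of_lt (show a < m + 1 by omega)]
    | succ b => simp [predChoose, Nat.choose_eq_zero_of_lt (show b < m by omega)]
  rw [h1, h2]
  simp

theorem u_self {m : ℕ} (hm : 0 < m) (x : ℤ) : u m m x =
    comp (act (perm21 ^ (m - 1)) (e x)) (e 0) (e m)
      + comp (act (perm21 ^ (m - 1)) (e x)) (e m) (act perm21 (e 0)) := by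
  obtain ⟨m, rfl⟩ : ∃ l, m = l + 1 := ⟨m - 1, by omega⟩
  rw [u_succ_eq_biSum, biSum, Finset.Nat.sum_antidiagonal_succ]
  congr 1
  · simp [predChoose]
  -- Apart from $a=0$, only $b=0$ survives: otherwise $0<b\le m$ and $\binom{b-1}{m}=0$.
  · rw [Finset.sum_eq_single (m, 0)]
    · simp [predChoose]
    · rintro ⟨a, b⟩ hab hne
      rw [Finset.HasAntidiagonal.mem_antidiagonal] at hab
      dsimp only at hab ⊢
      obtain ⟨b, rfl⟩ : ∃ l, b = l + 1 := ⟨b - 1, by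
        have : b ≠ 0 := by rintro rfl; exact hne (by simp [← hab])
        omega⟩
      simp [predChoose, Nat.choose_eq_zero_of_lt (show b < m by omega)]
    · intro h
      simp at h

/-! ### The elements $\alpha_{n,p}$ -/

/-- The partial sums of the first half of `α`. -/
def uSum (N : ℕ) (n p : ℤ) : E 4 :=
  ∑ s ∈ Finset.range N, u (s + 1) (s + p) (n - s - p)

/-- Terms with $s>n-p$ have root $e_x$ with $x<0$. A common length $N$ can thus serve for all the
sums in an identity. -/
theorem uSum_eq_of_le {N M : ℕ} {n p : ℤ} (hN : n - p < N) (hNM : N ≤ M) :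
    uSum N n p = uSum M n p := by
  refine Finset.sum_subset (Finset.range_mono hNM) fun s _ hs => u_root_of_neg ?_
  rw [Finset.mem_range] at hs
  omega

theorem α_eq_uSum {N : ℕ} {n p : ℤ} (hN : n - p < N) :
    α n p = uSum N n p + act perm3412 (uSum N n (p + 1)) := by
  rw [α, ← uSum_eq_of_le (N := (n - p + 1).toNat) (by omega) (by omega),
    ← uSum_eq_of_le (N := (n - p).toNat) (n := n) (p := p + 1) (by omega) (by omega)]
  simp only [uSum, map_sum, ← add_assoc, sub_add_eq_sub_sub]

theorem sum_u_lower {N : ℕ} {n p : ℤ} (hN : n - p < N) :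
    ∑ s ∈ Finset.range N, u s (s + (p - 1)) (n - s - p) = uSum N (n - 1) p := by
  cases N with
  | zero => simp [uSum]
  | succ N =>
    rw [← uSum_eq_of_le (n := n - 1) (p := p) (N := N) (by omega) N.le_succ,
      Finset.sum_range_succ', u_zero, add_zero, uSum]
    refine Finset.sum_congr rfl fun s _ => ?_
    have h1 : ((s + 1 : ℕ) : ℤ) + (p - 1) = s + p := by push_cast; ring
    have h2 : n - ((s + 1 : ℕ) : ℤ) - p = n - 1 - s - p := by push_cast; ring
    rw [h1, h2]

theorem d_uSum_term (s : ℕ) (n p : ℤ) : d (u (s + 1) (s + p) (n - s - p)) =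
    (u (s + 1) (s + (p - 1)) (n - 1 - s - (p - 1))
      + act perm2143 (u (s + 1) (s + (p - 1)) (n - 1 - s - (p - 1))))
    + (flip (u s (s + (p - 1)) (n - s - p)) + act perm4321 (u s (s + (p - 1)) (n - s - p)))
    + (u (s + 1) (s + p) (n - 1 - s - p) + flip (u (s + 1) (s + p) (n - 1 - s - p))) := by
  have h := d_u s (s + (p - 1)) (n - s - p)
  have h1 : (s : ℤ) + (p - 1) + 1 = s + p := by ring
  have h2 : n - s - p - 1 = n - 1 - s - p := by ring
  have h3 : n - 1 - s - (p - 1) = n - s - p := by ring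
  rw [h1, h2] at h
  rw [h, h3]

theorem add_add_add_cancel_outer {V : Type} [AddCommGroup V] [Module (ZMod 2) V] (v w x : V) :
    v + w + (x + v) = x + w := by
  rw [add_comm v w, add_comm x v, add_add_add_comm, ← add_assoc, add_assoc w v v,
    zmod_two_add_self, add_zero, add_comm]

theorem d_uSum {N : ℕ} {n p : ℤ} (hN : n - p < N) : d (uSum N n p) =
    (uSum N (n - 1) (p - 1) + act perm2143 (uSum N (n - 1) (p - 1)))
      + (uSum N (n - 1) p + act perm4321 (uSum N (n - 1) p)) := by
  -- The term $U_{n-1,p}\cdot F$ is inserted twice, to match the $F+(4321)$ and $\mathrm{Id}+F$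
  -- parts of the formula for $d[u]$.
  rw [← add_add_add_cancel_outer (flip (uSum N (n - 1) p)) (act perm4321 (uSum N (n - 1) p)),
    ← add_assoc]
  conv_rhs => enter [1, 2]; rw [← sum_u_lower hN]
  simp only [uSum, map_sum, d_uSum_term, Finset.sum_add_distrib]

theorem α_of_neg {n p : ℤ} (hp : p < 0) : α n p = 0 := by
  obtain ⟨q, rfl⟩ : ∃ q : ℕ, p = -((q : ℤ) + 1) := ⟨(-p - 1).toNat, by omega⟩
  have hzero : ∀ (s : ℕ) (r x : ℤ), r ≤ 0 → s + r ≠ 0 → u (s + 1) (s + r) x = 0 := by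
    intro s r x hr h
    rcases lt_or_gt_of_ne h with h | h
    · exact u_of_neg h
    · exact u_eq_zero h (by push_cast; omega)
  -- $N$ exceeds both $n-p=n+q+1$ and the index $q+1$. As $p<0$, a term survives only when its lower
  -- index is 0: $s=q+1$ in the first sum, $s=q$ in the second.
  rw [α_eq_uSum (N := (n + q + 2).toNat + q + 2) (by omega), uSum, uSum,
    Finset.sum_eq_single (q + 1), Finset.sum_eq_single q]
  · rw [show ((q : ℤ) + (-((q : ℤ) + 1) + 1)) = 0 by ring,
      show (((q + 1 : ℕ) : ℤ) + -((q : ℤ) + 1)) = 0 by push_cast; ring,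
      show n - (q : ℤ) - (-((q : ℤ) + 1) + 1) = n by ring,
      show n - ((q + 1 : ℕ) : ℤ) - -((q : ℤ) + 1) = n by push_cast; ring]
    simp only [u, Nat.succ_ne_zero, if_false, if_true, Nat.add_sub_cancel]
    -- Applying $(3412)$ to $e_n(21)^q(e_0,e_0)$ adds one more twist at the root, giving exactly the
    -- first surviving term.
    erw [← act_comp]
    rw [act_perm21_pow_succ]
    exact zmod_two_add_self (V := E 4) _
  · intro s _ hs
    exact hzero s _ _ (by omega) (by omega)
  · intro h
    exact absurd (Finset.mem_range.2 (by omega)) h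
  · intro s _ hs
    exact hzero s _ _ (by omega) (by omega)
  · intro h
    exact absurd (Finset.mem_range.2 (by omega)) h

theorem d_α (n p : ℤ) : d (α n p) =
    (α (n - 1) (p - 1) + act perm2143 (α (n - 1) (p - 1)))
      + (α (n - 1) p + act perm4321 (α (n - 1) p)) := by
  have h1 (a : E 4) : act perm2143 (act perm3412 a) = act perm3412 (act perm2143 a) :=
    by rw [act_act, act_act, show perm3412 * perm2143 = perm2143 * perm3412 by decide]
  have h2 (a : E 4) : act perm4321 (act perm3412 a) = act perm3412 (act perm4321 a) :=
    by rw [act_act, act_act, show perm3412 * perm4321 = perm4321 * perm3412 by decide]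
  have hN : n - p < ((n - p + 1).toNat : ℕ) := by omega
  generalize (n - p + 1).toNat = N at hN
  rw [α_eq_uSum hN, α_eq_uSum (n := n - 1) (p := p - 1) (N := N) (by omega),
    α_eq_uSum (n := n - 1) (p := p) (N := N) (by omega), map_add, d_act, d_uSum hN,
    d_uSum (p := p + 1) (by omega), add_sub_cancel_right, sub_add_cancel]
  simp only [map_add, h1, h2]
  abel

end

end AdemCartan

theorem proposition2p2p4 :
    (∀ (m : ℕ) (n x : ℤ), 0 < n → n < m → AdemCartan.u m n x = 0) ∧
    (∀ (m : ℕ) (x : ℤ), 0 < m →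
      AdemCartan.u m m x =
        AdemCartan.comp (AdemCartan.act (AdemCartan.perm21 ^ (m - 1)) (AdemCartan.e x))
          (AdemCartan.e 0) (AdemCartan.e m)
        + AdemCartan.comp (AdemCartan.act (AdemCartan.perm21 ^ (m - 1)) (AdemCartan.e x))
          (AdemCartan.e m) (AdemCartan.act AdemCartan.perm21 (AdemCartan.e 0))) ∧
    (∀ (m : ℕ) (n x : ℤ),
      AdemCartan.d (AdemCartan.u (m + 1) (n + 1) x) =
        (AdemCartan.u (m + 1) n x
          + AdemCartan.act AdemCartan.perm2143 (AdemCartan.u (m + 1) n x))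
        + (AdemCartan.flip (AdemCartan.u m n x)
          + AdemCartan.act AdemCartan.perm4321 (AdemCartan.u m n x))
        + (AdemCartan.u (m + 1) (n + 1) (x - 1)
          + AdemCartan.flip (AdemCartan.u (m + 1) (n + 1) (x - 1)))) ∧
    (∀ n p : ℤ, p < 0 → AdemCartan.α n p = 0) ∧
    (∀ n p : ℤ,
      AdemCartan.d (AdemCartan.α n p) =
        (AdemCartan.α (n - 1) (p - 1)
          + AdemCartan.act AdemCartan.perm2143 (AdemCartan.α (n - 1) (p - 1)))
        + (AdemCartan.α (n - 1) p
          + AdemCartan.act AdemCartan.perm4321 (AdemCartan.α (n - 1) p))) :=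
  ⟨fun _ _ _ => AdemCartan.u_eq_zero, fun _ x hm => AdemCartan.u_self hm x, AdemCartan.d_u,
    fun _ _ => AdemCartan.α_of_neg, AdemCartan.d_α⟩
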